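/- Let $n,m\ge 0$ and let $X:M\to\mathbb R^{m+n}$ be a smooth, properly immersed (hence, in the induced metric, complete) $n$-dimensional translator: $M$ is a smooth $n$-manifold, $X$ is a smooth immersion that is a proper map (equivalently, the closed extrinsic balls $\{x\in M: |X(x)-X(o)|\le a\}$ are compact for every $o\in M$ and $a\ge 0$), and there is a constant unit vector $V\in\mathbb R^{m+n}$ with $H=V^N$ on $M$. Here $H$ is the mean curvature vector, that is, the trace of the second fundamental form with respect to the induced metric, and $V^N$ is the orthogonal projection of $V$ onto the normal space. Let $\nabla$ and $\Delta$ be the gradient and the Laplace–Beltrami operator of the induced metric, and put $\mathcal L_{II}f=\Delta f+\langle V,\nabla f\rangle$. Fix $o\in M$ and let $r(x)=|X(x)-X(o)|$ be the extrinsic distance from $o$. Then for every $C^2$ function $f:M\to\mathbb R$ with $$\lim_{r(x)\to+\infty}\frac{f(x)}{r(x)}=0$$ there is a sequence $(x_k)$ of points of $M$ such that $$\lim_{k\to\infty}f(x_k)=\sup_M f\in(-\infty,+\infty],\qquad \lim_{k\to\infty}|\nabla f(x_k)|=0,\qquad \lim_{k\to\infty}\mathcal L_{II}f(x_k)\le 0,$$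 where the last limit exists in $[-\infty,+\infty]$. -/

import Mathlib

open scoped Manifold ContDiff Topology
open Filter

noncomputable section

namespace TranslatingSoliton

variable {n : ℕ} {M : Type*} [TopologicalSpace M] [ChartedSpace (EuclideanSpace ℝ (Fin n)) M]
  {F : Type*} [NormedAddCommGroup F] [InnerProductSpace ℝ F] [FiniteDimensional ℝ F]
  {G : Type*} [NormedAddCommGroup G] [NormedSpace ℝ G]

/-- The coordinates of the point `p` in the preferred chart around `p`. -/
def base (n : ℕ) {M : Type*} [TopologicalSpace M] [ChartedSpace (EuclideanSpace ℝ (Fin n)) M]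
    (p : M) : EuclideanSpace ℝ (Fin n) :=
  extChartAt (𝓡 n) p p

/-- The expression of a map on `M` in the preferred chart around `p`. -/
def localRep (h : M → G) (p : M) : EuclideanSpace ℝ (Fin n) → G :=
  fun u => h ((extChartAt (𝓡 n) p).symm u)

/-- The `i`-th partial derivative of a map on `ℝⁿ`. -/
def pd (i : Fin n) (h : EuclideanSpace ℝ (Fin n) → G) (u : EuclideanSpace ℝ (Fin n)) : G :=
  fderiv ℝ h u (EuclideanSpace.single i 1)

/-- The coefficients `g_ij = ⟨∂ᵢX, ∂ⱼX⟩` of the metric induced by `X`, in the chart around `p`,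
as functions of the coordinates `u`. -/
def metric (X : M → F) (p : M) (u : EuclideanSpace ℝ (Fin n)) : Matrix (Fin n) (Fin n) ℝ :=
  Matrix.of fun i j => inner ℝ (pd i (localRep X p) u) (pd j (localRep X p) u)

/-- The coefficients `g^ij` of the inverse of the induced metric at `p`. -/
def invMetric (n : ℕ) {M : Type*} [TopologicalSpace M]
    [ChartedSpace (EuclideanSpace ℝ (Fin n)) M] (X : M → F) (p : M) :
    Matrix (Fin n) (Fin n) ℝ :=
  (metric X p (base n p))⁻¹

/-- The Christoffel symbols `Γᵏᵢⱼ` at `p` of the Levi-Civita connection of the induced metric. -/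
def christoffel (X : M → F) (p : M) (k i j : Fin n) : ℝ :=
  (1 / 2) * ∑ l, invMetric n X p k l *
    (pd i (fun u => metric X p u j l) (base n p) + pd j (fun u => metric X p u i l) (base n p)
      - pd l (fun u => metric X p u i j) (base n p))

/-- The gradient `∇f` at `p` for the induced metric, viewed through `dX` as a vector of the ambient
space: `∑ g^ij ∂ᵢf ∂ⱼX`. Its ambient norm is the norm of `∇f` in the induced metric. -/
def grad (n : ℕ) {M : Type*} [TopologicalSpace M] [ChartedSpace (EuclideanSpace ℝ (Fin n)) M]
    (X : M → F) (f : M → ℝ) (p : M) : F :=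
  ∑ i, ∑ j, (invMetric n X p i j * pd i (localRep f p) (base n p)) •
    pd j (localRep X p) (base n p)

/-- The Laplace-Beltrami operator of the induced metric:
`Δf = ∑ g^ij (∂ᵢ∂ⱼf - ∑ Γᵏᵢⱼ ∂ₖf)`. -/
def laplacian (n : ℕ) {M : Type*} [TopologicalSpace M]
    [ChartedSpace (EuclideanSpace ℝ (Fin n)) M] (X : M → F) (f : M → ℝ) (p : M) : ℝ :=
  ∑ i, ∑ j, invMetric n X p i j *
    (pd i (pd j (localRep f p)) (base n p)
      - ∑ k, christoffel X p k i j * pd k (localRep f p) (base n p))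

/-- The tangent space of the immersed submanifold at `p`, as a subspace `dX(TₚM)` of the ambient
space. -/
def tangentImage (n : ℕ) {M : Type*} [TopologicalSpace M]
    [ChartedSpace (EuclideanSpace ℝ (Fin n)) M] (X : M → F) (p : M) : Submodule ℝ F :=
  Submodule.span ℝ (Set.range fun i : Fin n => pd i (localRep X p) (base n p))

/-- The orthogonal projection `w ↦ wᴺ` onto the normal space at `p`. -/
def normalPart (n : ℕ) {M : Type*} [TopologicalSpace M]
    [ChartedSpace (EuclideanSpace ℝ (Fin n)) M] (X : M → F) (p : M) (w : F) : F :=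
  (tangentImage n X p)ᗮ.starProjection w

/-- The second fundamental form `B(∂ᵢ, ∂ⱼ) = (∂ᵢ∂ⱼX)ᴺ` at `p`. -/
def secondFundamentalForm (X : M → F) (p : M) (i j : Fin n) : F :=
  normalPart n X p (pd i (pd j (localRep X p)) (base n p))

/-- The mean curvature vector, the trace of the second fundamental form: `H = ∑ g^ij B(∂ᵢ, ∂ⱼ)`. -/
def meanCurvature (n : ℕ) {M : Type*} [TopologicalSpace M]
    [ChartedSpace (EuclideanSpace ℝ (Fin n)) M] (X : M → F) (p : M) : F :=
  ∑ i, ∑ j, invMetric n X p i j • secondFundamentalForm X p i j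

/-- `X` is a smooth immersion of the `n`-manifold `M` which is a translator in the direction of the
unit vector `V`, that is, `H = Vᴺ`. -/
structure IsTranslator (n : ℕ) {M : Type*} [TopologicalSpace M]
    [ChartedSpace (EuclideanSpace ℝ (Fin n)) M] (V : F) (X : M → F) : Prop where
  smooth : ContMDiff (𝓡 n) 𝓘(ℝ, F) ∞ X
  immersion : ∀ p, Function.Injective (mfderiv (𝓡 n) 𝓘(ℝ, F) X p)
  norm_eq_one : ‖V‖ = 1
  meanCurvature_eq : ∀ p, meanCurvature n X p = normalPart n X p V

/-- The drift Laplacian `L_II f = Δf + ⟨V, ∇f⟩`. -/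
def driftLaplacian (n : ℕ) {M : Type*} [TopologicalSpace M]
    [ChartedSpace (EuclideanSpace ℝ (Fin n)) M] (V : F) (X : M → F) (f : M → ℝ) (p : M) : ℝ :=
  laplacian n X f p + inner ℝ V (grad n X f p)

/-- The extrinsic distance from the point `o` of `M`. -/
def extrinsicDist {M : Type*} (X : M → F) (o x : M) : ℝ := ‖X x - X o‖

end TranslatingSoliton

end

/-!
The proof perturbs `f` by a multiple of the weight `γ = √(1 + r²)`. As `f` grows more slowly than
`r` and `X` is proper, `f - γ / (k + 1)` attains its maximum at some point `x k`
(`exists_isMax_sub_distWeight`), and these points form a maximizing sequence for `f`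
(`tendsto_iSup_of_isMax`). At `x k` the first and second order conditions for a maximum give
`∇f = ∇γ / (k + 1)` and `L_II f ≤ L_II γ / (k + 1)`
(`grad_eq_and_driftLaplacian_le_of_isLocalMax`).

It remains to bound `∇γ` and `L_II γ`. The vector `γ ∇γ` is the tangential part of `X - X(o)`, so
that `|∇γ| ≤ 1` (`norm_grad_distWeight_le_one`). By the Gauss formula,
`γ Δγ = n + ⟨H, X - X(o)⟩ - |∇γ|²`, and `γ ⟨V, ∇γ⟩ = ⟨Vᵀ, X - X(o)⟩`. Because `H = Vᴺ`, the two
inner products add up to `⟨V, X - X(o)⟩ ≤ γ`, whence `L_II γ ≤ n + 1`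
(`driftLaplacian_distWeight_le`). No bound on the curvature is needed. A subsequence along which
`L_II f` converges in the extended reals completes the proof.
-/

namespace TranslatingSoliton

/-! ### Gram matrices and semidefinite forms -/

open scoped MatrixOrder in
/-- The trace of the product of a positive semidefinite matrix and a negative semidefinite form is
nonpositive: factoring `A = CᵀC` turns the trace into the sum of the values of the form on the rows
of `C`. -/
theorem sum_mul_nonpos_of_posSemidef {ι : Type*} [Fintype ι] [DecidableEq ι]
    {A : Matrix ι ι ℝ} (hA : A.PosSemidef) {B : ι → ι → ℝ}
    (hB : ∀ v : ι → ℝ, ∑ i, ∑ j, v i * v j * B i j ≤ 0) :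
    ∑ i, ∑ j, A i j * B i j ≤ 0 := by
  obtain ⟨C, rfl⟩ := CStarAlgebra.nonneg_iff_eq_star_mul_self.mp hA.nonneg
  have h : ∑ i, ∑ j, (star C * C) i j * B i j = ∑ k, ∑ i, ∑ j, C k i * C k j * B i j := by
    simp only [Matrix.star_eq_conjTranspose, Matrix.mul_apply, Matrix.conjTranspose_apply,
      star_trivial, Finset.sum_mul]
    rw [Finset.sum_comm]
    conv_rhs => rw [Finset.sum_comm]
    rw [Finset.sum_comm]
    exact Finset.sum_congr rfl fun i _ => Finset.sum_comm
  rw [h]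
  exact Finset.sum_nonpos fun k _ => hB (C k)

/-- The orthogonal projection onto the span of a linearly independent family, through the inverse of
its Gram matrix. -/
theorem starProjection_span_range {F : Type*} [NormedAddCommGroup F] [InnerProductSpace ℝ F]
    [FiniteDimensional ℝ F] {ι : Type*} [Fintype ι] [DecidableEq ι] {e : ι → F}
    (he : LinearIndependent ℝ e) (w : F) :
    (Submodule.span ℝ (Set.range e)).starProjection w =
      ∑ i, ∑ j, ((Matrix.gram ℝ e)⁻¹ i j * inner ℝ (e i) w) • e j := by
  have hdet : IsUnit (Matrix.gram ℝ e).det :=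
    (Matrix.det_gram_ne_zero_iff_linearIndependent.mpr he).isUnit
  apply Submodule.eq_starProjection_of_mem_of_inner_eq_zero
  · exact Submodule.sum_mem _ fun i _ => Submodule.sum_mem _ fun j _ =>
      Submodule.smul_mem _ _ (Submodule.subset_span ⟨j, rfl⟩)
  · intro v hv
    induction hv using Submodule.span_induction with
    | mem v hv =>
      obtain ⟨k, rfl⟩ := hv
      have h : ∀ i, ∑ j, (Matrix.gram ℝ e)⁻¹ i j * inner ℝ (e j) (e k) =
          if i = k then 1 else 0 := by
        intro i
        have := congrFun (congrFun (Matrix.nonsing_inv_mul _ hdet) i) k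
        simpa [Matrix.mul_apply, Matrix.one_apply] using this
      simp only [inner_sub_left, sum_inner, inner_smul_left, conj_trivial]
      rw [sub_eq_zero, real_inner_comm]
      symm
      calc ∑ i, ∑ j, (Matrix.gram ℝ e)⁻¹ i j * inner ℝ (e i) w * inner ℝ (e j) (e k)
          = ∑ i, inner ℝ (e i) w * ∑ j, (Matrix.gram ℝ e)⁻¹ i j * inner ℝ (e j) (e k) := by
            refine Finset.sum_congr rfl fun i _ => ?_
            rw [Finset.mul_sum]
            exact Finset.sum_congr rfl fun j _ => by ring
        _ = _ := by simp [h]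
    | zero => simp
    | add x y _ _ hx hy => rw [inner_add_right, hx, hy, add_zero]
    | smul a x _ hx => rw [inner_smul_right, hx, mul_zero]

/-! ### Partial derivatives in Euclidean space -/

section Calculus

variable {n : ℕ} {G : Type*} [NormedAddCommGroup G] [NormedSpace ℝ G]
  {h : EuclideanSpace ℝ (Fin n) → G} {u : EuclideanSpace ℝ (Fin n)}

theorem differentiableAt_fderiv (hh : ContDiffAt ℝ 2 h u) :
    DifferentiableAt ℝ (fderiv ℝ h) u :=
  (hh.fderiv_right (m := 1) (by norm_num)).differentiableAt (by norm_num)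

theorem differentiableAt_pd (hh : ContDiffAt ℝ 2 h u) (j : Fin n) :
    DifferentiableAt ℝ (pd j h) u :=
  (differentiableAt_fderiv hh).clm_apply (differentiableAt_const _)

theorem pd_pd_eq (hh : ContDiffAt ℝ 2 h u) (i j : Fin n) :
    pd i (pd j h) u =
      fderiv ℝ (fderiv ℝ h) u (EuclideanSpace.single i 1) (EuclideanSpace.single j 1) := by
  unfold pd
  rw [fderiv_clm_apply (differentiableAt_fderiv hh) (differentiableAt_const _)]
  simp

theorem pd_pd_comm (hh : ContDiffAt ℝ 2 h u) (i j : Fin n) :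
    pd i (pd j h) u = pd j (pd i h) u := by
  rw [pd_pd_eq hh, pd_pd_eq hh]
  exact (hh.isSymmSndFDerivAt (by simp)).eq _ _

theorem pd_congr {h' : EuclideanSpace ℝ (Fin n) → G} (hh : h =ᶠ[𝓝 u] h') (i : Fin n) :
    pd i h u = pd i h' u := by
  unfold pd
  rw [hh.fderiv_eq]

theorem pd_sub {h' : EuclideanSpace ℝ (Fin n) → G} (hh : DifferentiableAt ℝ h u)
    (hh' : DifferentiableAt ℝ h' u) (i : Fin n) :
    pd i (fun x => h x - h' x) u = pd i h u - pd i h' u := by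
  unfold pd
  rw [fderiv_fun_sub hh hh']
  simp

theorem pd_const_mul {h : EuclideanSpace ℝ (Fin n) → ℝ} (hh : DifferentiableAt ℝ h u) (c : ℝ)
    (i : Fin n) : pd i (fun x => c * h x) u = c * pd i h u := by
  unfold pd
  rw [fderiv_const_mul hh]
  simp

theorem pd_mul {h h' : EuclideanSpace ℝ (Fin n) → ℝ} (hh : DifferentiableAt ℝ h u)
    (hh' : DifferentiableAt ℝ h' u) (i : Fin n) :
    pd i (fun x => h x * h' x) u = pd i h u * h' u + h u * pd i h' u := by
  unfold pd
  rw [fderiv_fun_mul hh hh']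
  simp
  ring

theorem pd_inner {F : Type*} [NormedAddCommGroup F] [InnerProductSpace ℝ F]
    {h h' : EuclideanSpace ℝ (Fin n) → F} (hh : DifferentiableAt ℝ h u)
    (hh' : DifferentiableAt ℝ h' u) (i : Fin n) :
    pd i (fun x => inner ℝ (h x) (h' x)) u =
      inner ℝ (pd i h u) (h' u) + inner ℝ (h u) (pd i h' u) := by
  unfold pd
  rw [fderiv_inner_apply ℝ hh hh', add_comm]

theorem pd_sub_const {F : Type*} [NormedAddCommGroup F] [NormedSpace ℝ F]
    {h : EuclideanSpace ℝ (Fin n) → F} (c : F) (i : Fin n) :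
    pd i (fun x => h x - c) u = pd i h u := by
  unfold pd
  rw [fderiv_sub_const]

theorem pd_eq_zero_of_isLocalMax {h : EuclideanSpace ℝ (Fin n) → ℝ} (hmax : IsLocalMax h u)
    (i : Fin n) : pd i h u = 0 := by
  simp [pd, hmax.fderiv_eq_zero]

/-- The second order necessary condition for a local maximum, obtained by restriction to the lines
through the point. -/
theorem fderiv_fderiv_nonpos_of_isLocalMax {E : Type*} [NormedAddCommGroup E] [NormedSpace ℝ E]
    {h : E → ℝ} {u : E} (hh : ContDiffAt ℝ 2 h u) (hmax : IsLocalMax h u) (v : E) :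
    fderiv ℝ (fderiv ℝ h) u v v ≤ 0 := by
  by_contra! hpos
  have hline : ∀ t : ℝ, HasDerivAt (fun t : ℝ => u + t • v) v t := fun t => by
    simpa using ((hasDerivAt_id t).smul_const v).const_add u
  have hcont : Tendsto (fun t : ℝ => u + t • v) (𝓝 0) (𝓝 u) := by
    simpa using (hline 0).continuousAt.tendsto
  have hd : ∀ᶠ t : ℝ in 𝓝 0, deriv (fun t : ℝ => h (u + t • v)) t = fderiv ℝ h (u + t • v) v := by
    have hev : ∀ᶠ y in 𝓝 u, DifferentiableAt ℝ h y :=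
      (hh.eventually (by simp)).mono fun y hy => hy.differentiableAt (by norm_num)
    filter_upwards [hcont.eventually hev] with t ht
    exact (ht.hasFDerivAt.comp_hasDerivAt t (hline t)).deriv
  have hD : HasFDerivAt (fderiv ℝ h) (fderiv ℝ (fderiv ℝ h) u) (u + (0 : ℝ) • v) := by
    simpa using ((hh.fderiv_right (m := 1) (by norm_num)).differentiableAt
      (by norm_num)).hasFDerivAt
  have hdd : deriv (deriv fun t : ℝ => h (u + t • v)) 0 = fderiv ℝ (fderiv ℝ h) u v v := by
    rw [EventuallyEq.deriv_eq hd]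
    have hD' : HasDerivAt (fun t : ℝ => fderiv ℝ h (u + t • v)) (fderiv ℝ (fderiv ℝ h) u v) 0 :=
      hD.comp_hasDerivAt (0 : ℝ) (hline 0)
    have hD'' : HasDerivAt (fun t : ℝ => fderiv ℝ h (u + t • v) v)
        (fderiv ℝ (fderiv ℝ h) u v v) 0 := by
      simpa using hD'.clm_apply (hasDerivAt_const (0 : ℝ) v)
    exact hD''.deriv
  have hmax' : IsLocalMax (fun t : ℝ => h (u + t • v)) 0 := by
    have := hcont.eventually hmax
    simpa [IsLocalMax, IsMaxFilter] using this
  have hc : ContinuousAt (fun t : ℝ => h (u + t • v)) 0 := by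
    have : ContinuousAt h (u + (0 : ℝ) • v) := by simpa using hh.continuousAt
    exact this.comp (f := fun t : ℝ => u + t • v) (hline 0).continuousAt
  have hmin := isLocalMin_of_deriv_deriv_pos (hdd ▸ hpos) hmax'.deriv_eq_zero hc
  -- a function with both a local maximum and a local minimum at `0` is constant near `0`
  have hconst : (fun t : ℝ => h (u + t • v)) =ᶠ[𝓝 0] fun _ => h (u + (0 : ℝ) • v) := by
    filter_upwards [hmax', hmin] with t h1 h2
    exact le_antisymm h1 h2
  have h0 : deriv (deriv fun t : ℝ => h (u + t • v)) 0 = 0 := by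
    rw [hconst.deriv.deriv_eq]
    simp
  exact hpos.ne' (hdd ▸ h0)

theorem sum_mul_pd_pd_nonpos_of_isLocalMax {h : EuclideanSpace ℝ (Fin n) → ℝ}
    (hh : ContDiffAt ℝ 2 h u) (hmax : IsLocalMax h u) {A : Matrix (Fin n) (Fin n) ℝ}
    (hA : A.PosSemidef) : ∑ i, ∑ j, A i j * pd i (pd j h) u ≤ 0 := by
  refine sum_mul_nonpos_of_posSemidef hA fun v => ?_
  have hv := fderiv_fderiv_nonpos_of_isLocalMax hh hmax
    (∑ i, v i • EuclideanSpace.single i (1 : ℝ))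
  refine le_of_eq_of_le ?_ hv
  simp only [map_sum, map_smul, FunLike.coe_sum, Finset.sum_apply, FunLike.coe_smul,
    Pi.smul_apply, smul_eq_mul, pd_pd_eq hh, Finset.mul_sum]
  rw [Finset.sum_comm]
  exact Finset.sum_congr rfl fun i _ => Finset.sum_congr rfl fun j _ => by ring

end Calculus

/-! ### The induced metric of an immersion -/

section Geometry

variable {n : ℕ} {M : Type*} [TopologicalSpace M] [ChartedSpace (EuclideanSpace ℝ (Fin n)) M]
  {F : Type*} [NormedAddCommGroup F] [InnerProductSpace ℝ F]

theorem localRep_base {G : Type*} (h : M → G) (p : M) : localRep h p (base n p) = h p := by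
  rw [localRep, base, extChartAt_to_inv]

theorem contDiffAt_localRep {G : Type*} [NormedAddCommGroup G] [NormedSpace ℝ G] {k : ℕ∞ω}
    {h : M → G} {p : M} (hh : ContMDiffAt (𝓡 n) 𝓘(ℝ, G) k h p) :
    ContDiffAt ℝ k (localRep h p) (base n p) := by
  have := (contMDiffAt_iff.mp hh).2
  unfold localRep base
  simpa [contDiffWithinAt_univ, Function.comp_def, chartAt_self_eq] using this

/-- An immersion has linearly independent partial derivatives in the preferred chart. -/
theorem linearIndependent_pd_localRep {X : M → F} {p : M}
    (hX : MDifferentiableAt (𝓡 n) 𝓘(ℝ, F) X p)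
    (hinj : Function.Injective (mfderiv (𝓡 n) 𝓘(ℝ, F) X p)) :
    LinearIndependent ℝ fun i => pd i (localRep X p) (base n p) := by
  have h : mfderiv (𝓡 n) 𝓘(ℝ, F) X p = fderiv ℝ (localRep X p) (base n p) := by
    rw [hX.mfderiv]
    simp only [modelWithCornersSelf_coe, Set.range_id, fderivWithin_univ]
    rfl
  have hinj' : Function.Injective (fderiv ℝ (localRep X p) (base n p)) := h ▸ hinj
  have hb := (EuclideanSpace.basisFun (Fin n) ℝ).toBasis.linearIndependent
  have := hb.map' (fderiv ℝ (localRep X p) (base n p)).toLinearMap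
    (LinearMap.ker_eq_bot.mpr hinj')
  simpa [Function.comp_def, pd] using this

theorem invMetric_eq_inv_gram (X : M → F) (p : M) :
    invMetric n X p = (Matrix.gram ℝ fun i => pd i (localRep X p) (base n p))⁻¹ := rfl

theorem invMetric_symm (X : M → F) (p : M) (i j : Fin n) :
    invMetric n X p i j = invMetric n X p j i := by
  have h : (invMetric n X p).IsHermitian := (Matrix.isHermitian_gram ℝ _).inv
  simpa using (h.apply i j).symm

theorem posSemidef_invMetric (X : M → F) (p : M) : (invMetric n X p).PosSemidef :=
  (Matrix.posSemidef_gram ℝ _).inv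

/-- The Christoffel symbols of an induced metric are the tangential components of the second
derivatives of the immersion: `Γᵏᵢⱼ = ∑ gᵏˡ ⟨∂ₗX, ∂ᵢ∂ⱼX⟩`. -/
theorem christoffel_eq {X : M → F} {p : M} (hX : ContDiffAt ℝ 2 (localRep X p) (base n p))
    (k i j : Fin n) :
    christoffel X p k i j = ∑ l, invMetric n X p k l *
      inner ℝ (pd l (localRep X p) (base n p)) (pd i (pd j (localRep X p)) (base n p)) := by
  have hm : ∀ a b c, pd a (fun u => metric X p u b c) (base n p) =
      inner ℝ (pd a (pd b (localRep X p)) (base n p)) (pd c (localRep X p) (base n p)) +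
      inner ℝ (pd b (localRep X p) (base n p)) (pd a (pd c (localRep X p)) (base n p)) :=
    fun a b c => pd_inner (differentiableAt_pd hX b) (differentiableAt_pd hX c) a
  rw [christoffel, Finset.mul_sum]
  refine Finset.sum_congr rfl fun l _ => ?_
  rw [hm i j l, hm j i l, hm l i j, pd_pd_comm hX j i, pd_pd_comm hX l i, pd_pd_comm hX l j,
    real_inner_comm (pd l (localRep X p) (base n p)),
    real_inner_comm (pd i (pd l (localRep X p)) (base n p)) (pd j (localRep X p) (base n p))]
  ring

/-- The trace of the metric with respect to itself is the dimension of the manifold. -/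
theorem sum_invMetric_mul_metric {X : M → F} {p : M}
    (hli : LinearIndependent ℝ fun i => pd i (localRep X p) (base n p)) :
    ∑ i, ∑ j, invMetric n X p i j *
      inner ℝ (pd i (localRep X p) (base n p)) (pd j (localRep X p) (base n p)) = n := by
  set g := Matrix.gram ℝ fun i => pd i (localRep X p) (base n p)
  have hdet : IsUnit g.det :=
    (Matrix.det_gram_ne_zero_iff_linearIndependent.mpr hli).isUnit
  have htr : (g⁻¹ * g).trace = n := by
    rw [Matrix.nonsing_inv_mul _ hdet, Matrix.trace_one, Fintype.card_fin]
  rw [← htr, Matrix.trace]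
  refine Finset.sum_congr rfl fun i _ => ?_
  rw [Matrix.diag_apply, Matrix.mul_apply]
  refine Finset.sum_congr rfl fun j _ => ?_
  rw [invMetric_eq_inv_gram, real_inner_comm]
  rfl

theorem pd_pd_localRep_sub_const_mul {f γ : M → ℝ} {p : M} (c : ℝ)
    (hf : ContDiffAt ℝ 2 (localRep f p) (base n p))
    (hγ : ContDiffAt ℝ 2 (localRep γ p) (base n p)) (i j : Fin n) :
    pd i (pd j (localRep (fun x => f x - c * γ x) p)) (base n p) =
      pd i (pd j (localRep f p)) (base n p) - c * pd i (pd j (localRep γ p)) (base n p) := by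
  have h1 : ∀ᶠ u in 𝓝 (base n p), pd j (localRep (fun x => f x - c * γ x) p) u =
      pd j (localRep f p) u - c * pd j (localRep γ p) u := by
    filter_upwards [hf.eventually (by simp), hγ.eventually (by simp)] with u h1 h2
    have h1' := h1.differentiableAt (by norm_num)
    have h2' := h2.differentiableAt (by norm_num)
    exact (pd_sub h1' (h2'.const_mul c) j).trans (by rw [pd_const_mul h2'])
  rw [pd_congr h1, pd_sub (differentiableAt_pd hf j) ((differentiableAt_pd hγ j).const_mul c),
    pd_const_mul (differentiableAt_pd hγ j)]

/-- At a local maximum of `f - c γ`, the gradients of `f` and `c γ` agree. The first order terms of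
the two drift Laplacians then cancel, and the second order terms are compared by the trace of the
Hessian of `f - c γ`. -/
theorem grad_eq_and_driftLaplacian_le_of_isLocalMax {V : F} {X : M → F} {f γ : M → ℝ}
    {p : M} {c : ℝ}
    (hf : ContDiffAt ℝ 2 (localRep f p) (base n p))
    (hγ : ContDiffAt ℝ 2 (localRep γ p) (base n p))
    (hmax : IsLocalMax (localRep (fun x => f x - c * γ x) p) (base n p)) :
    grad n X f p = c • grad n X γ p ∧
      driftLaplacian n V X f p ≤ c * driftLaplacian n V X γ p := by
  have hpd : ∀ i, pd i (localRep f p) (base n p) = c * pd i (localRep γ p) (base n p) := by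
    intro i
    have h0 := pd_eq_zero_of_isLocalMax hmax i
    have h1' := hf.differentiableAt (by norm_num)
    have h2' := hγ.differentiableAt (by norm_num)
    have h := pd_sub h1' (h2'.const_mul c) i
    rw [pd_const_mul h2'] at h
    exact sub_eq_zero.mp (h.symm.trans h0)
  have hgrad : grad n X f p = c • grad n X γ p := by
    simp_rw [grad, hpd, Finset.smul_sum, smul_smul]
    exact Finset.sum_congr rfl fun i _ => Finset.sum_congr rfl fun j _ => by ring_nf
  refine ⟨hgrad, ?_⟩
  have hcd : ContDiffAt ℝ 2 (localRep (fun x => f x - c * γ x) p) (base n p) :=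
    hf.sub (contDiffAt_const.mul hγ)
  have htr := sum_mul_pd_pd_nonpos_of_isLocalMax hcd hmax (posSemidef_invMetric X p)
  have hlap : laplacian n X f p - c * laplacian n X γ p = ∑ i, ∑ j, invMetric n X p i j *
      pd i (pd j (localRep (fun x => f x - c * γ x) p)) (base n p) := by
    simp_rw [laplacian, Finset.mul_sum, ← Finset.sum_sub_distrib]
    refine Finset.sum_congr rfl fun i _ => Finset.sum_congr rfl fun j _ => ?_
    rw [pd_pd_localRep_sub_const_mul c hf hγ]
    have : ∑ k, christoffel X p k i j * pd k (localRep f p) (base n p) =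
        c * ∑ k, christoffel X p k i j * pd k (localRep γ p) (base n p) := by
      rw [Finset.mul_sum]
      exact Finset.sum_congr rfl fun k _ => by rw [hpd]; ring
    rw [this]
    ring
  rw [driftLaplacian, driftLaplacian, hgrad, inner_smul_right]
  linarith

variable [FiniteDimensional ℝ F]

theorem starProjection_tangentImage {X : M → F} {p : M}
    (hli : LinearIndependent ℝ fun i => pd i (localRep X p) (base n p)) (w : F) :
    (tangentImage n X p).starProjection w = ∑ i, ∑ j, (invMetric n X p i j *
      inner ℝ (pd i (localRep X p) (base n p)) w) • pd j (localRep X p) (base n p) :=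
  starProjection_span_range hli w

theorem normalPart_eq_sub (X : M → F) (p : M) (w : F) :
    normalPart n X p w = w - (tangentImage n X p).starProjection w := by
  rw [normalPart, Submodule.starProjection_orthogonal]
  rfl

/-- The Gauss formula: the second fundamental form is the covariant Hessian of the immersion. -/
theorem secondFundamentalForm_eq {X : M → F} {p : M}
    (hX : ContDiffAt ℝ 2 (localRep X p) (base n p))
    (hli : LinearIndependent ℝ fun i => pd i (localRep X p) (base n p)) (i j : Fin n) :
    secondFundamentalForm X p i j = pd i (pd j (localRep X p)) (base n p) -
      ∑ k, christoffel X p k i j • pd k (localRep X p) (base n p) := by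
  rw [secondFundamentalForm, normalPart_eq_sub, starProjection_tangentImage hli, Finset.sum_comm]
  simp_rw [christoffel_eq hX, Finset.sum_smul]
  congr 1
  refine Finset.sum_congr rfl fun k _ => Finset.sum_congr rfl fun l _ => ?_
  rw [invMetric_symm]

/-- If `df` is the restriction of the pairing with an ambient vector `w`, then `∇f` is the
tangential part of `w`. -/
theorem grad_eq_starProjection {X : M → F} {p : M}
    (hli : LinearIndependent ℝ fun i => pd i (localRep X p) (base n p)) {f : M → ℝ} {w : F}
    (hw : ∀ i, pd i (localRep f p) (base n p) =
      inner ℝ (pd i (localRep X p) (base n p)) w) :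
    grad n X f p = (tangentImage n X p).starProjection w := by
  rw [starProjection_tangentImage hli, grad]
  simp_rw [hw]

end Geometry

/-! ### The weight `√(1 + r²)` -/

section Weight

variable {n : ℕ} {M : Type*} [TopologicalSpace M] [ChartedSpace (EuclideanSpace ℝ (Fin n)) M]
  {F : Type*} [NormedAddCommGroup F]

/-- The function `√(1 + r²)`, where `r` is the extrinsic distance from `o`. It is comparable with
`r` at infinity and, unlike `r`, smooth where `r` vanishes. -/
noncomputable def distWeight {M : Type*} (X : M → F) (o x : M) : ℝ :=
  √(1 + extrinsicDist X o x ^ 2)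

theorem one_le_distWeight {M : Type*} (X : M → F) (o x : M) : 1 ≤ distWeight X o x :=
  Real.one_le_sqrt.mpr (by nlinarith [sq_nonneg (extrinsicDist X o x)])

theorem extrinsicDist_le_distWeight {M : Type*} (X : M → F) (o x : M) :
    extrinsicDist X o x ≤ distWeight X o x :=
  Real.le_sqrt_of_sq_le (by linarith)

variable [InnerProductSpace ℝ F]

theorem distWeight_mul_self {M : Type*} (X : M → F) (o x : M) :
    distWeight X o x * distWeight X o x = 1 + inner ℝ (X x - X o) (X x - X o) := by
  rw [distWeight, Real.mul_self_sqrt (by positivity), extrinsicDist,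
    real_inner_self_eq_norm_sq]

theorem contDiffAt_localRep_distWeight {X : M → F} (o : M) {p : M} {k : ℕ∞ω}
    {u : EuclideanSpace ℝ (Fin n)} (hX : ContDiffAt ℝ k (localRep X p) u) :
    ContDiffAt ℝ k (localRep (distWeight X o) p) u := by
  have h : ContDiffAt ℝ k (fun u => 1 + ‖localRep X p u - X o‖ ^ 2) u :=
    contDiffAt_const.add ((hX.sub contDiffAt_const).norm_sq ℝ)
  exact h.sqrt (by positivity)

/-- With `γ = √(1 + |X - X(o)|²)`, half the derivative of `γ²`: `γ ∂ⱼγ = ⟨∂ⱼX, X - X(o)⟩`. -/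
theorem distWeight_mul_pd {X : M → F} (o : M) {p : M} {u : EuclideanSpace ℝ (Fin n)}
    (hX : ContDiffAt ℝ 2 (localRep X p) u) (j : Fin n) :
    localRep (distWeight X o) p u * pd j (localRep (distWeight X o) p) u =
      inner ℝ (pd j (localRep X p) u) (localRep X p u - X o) := by
  have hγ := (contDiffAt_localRep_distWeight o hX).differentiableAt (by norm_num)
  have hX' : DifferentiableAt ℝ (fun u => localRep X p u - X o) u :=
    (hX.differentiableAt (by norm_num)).sub_const _
  have h1 := pd_mul hγ hγ j
  have h2 := pd_inner hX' hX' j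
  have h3 : (fun x : EuclideanSpace ℝ (Fin n) =>
      localRep (distWeight X o) p x * localRep (distWeight X o) p x) = fun x =>
        inner ℝ (localRep X p x - X o) (localRep X p x - X o) - (-1) := by
    funext x
    have := distWeight_mul_self X o ((extChartAt (𝓡 n) p).symm x)
    simp only [localRep]
    rw [this]
    ring
  rw [h3, pd_sub_const, h2, pd_sub_const, real_inner_comm (localRep X p u - X o)] at h1
  rw [real_inner_comm (localRep X p u - X o)]
  linarith

/-- Differentiating `γ ∂ⱼγ = ⟨∂ⱼX, X - X(o)⟩` once more. -/
theorem distWeight_mul_pd_pd {X : M → F} (o : M) {p : M}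
    (hX : ContDiffAt ℝ 2 (localRep X p) (base n p)) (i j : Fin n) :
    distWeight X o p * pd i (pd j (localRep (distWeight X o) p)) (base n p) =
      inner ℝ (pd i (localRep X p) (base n p)) (pd j (localRep X p) (base n p)) +
      inner ℝ (pd i (pd j (localRep X p)) (base n p)) (X p - X o) -
      pd i (localRep (distWeight X o) p) (base n p) *
        pd j (localRep (distWeight X o) p) (base n p) := by
  have hγ := contDiffAt_localRep_distWeight o hX
  have hX' : DifferentiableAt ℝ (fun u => localRep X p u - X o) (base n p) :=
    (hX.differentiableAt (by norm_num)).sub_const _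
  have h1 := pd_mul (hγ.differentiableAt (by norm_num)) (differentiableAt_pd hγ j) i
  have h2 := pd_inner (differentiableAt_pd hX j) hX' i
  have h3 : (fun x => localRep (distWeight X o) p x * pd j (localRep (distWeight X o) p) x)
      =ᶠ[𝓝 (base n p)]
      fun x => inner ℝ (pd j (localRep X p) x) (localRep X p x - X o) := by
    filter_upwards [hX.eventually (by simp)] with u hu
    exact distWeight_mul_pd o hu j
  rw [pd_congr h3, h2, pd_sub_const] at h1
  rw [localRep_base, localRep_base] at h1
  rw [real_inner_comm (pd j (localRep X p) (base n p)) (pd i (localRep X p) (base n p))]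
  linarith

variable [FiniteDimensional ℝ F]

/-- `γ ∇γ` is the tangential part of the position vector `X - X(o)`. -/
theorem distWeight_smul_grad {X : M → F} (o : M) {p : M}
    (hX : ContDiffAt ℝ 2 (localRep X p) (base n p))
    (hli : LinearIndependent ℝ fun i => pd i (localRep X p) (base n p)) :
    distWeight X o p • grad n X (distWeight X o) p =
      (tangentImage n X p).starProjection (X p - X o) := by
  have hpos : distWeight X o p ≠ 0 := (zero_lt_one.trans_le (one_le_distWeight X o p)).ne'
  have h : grad n X (distWeight X o) p = (tangentImage n X p).starProjection
      ((distWeight X o p)⁻¹ • (X p - X o)) := by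
    refine grad_eq_starProjection hli fun i => ?_
    have h := distWeight_mul_pd o hX i
    rw [localRep_base, localRep_base] at h
    rw [inner_smul_right, ← h, inv_mul_cancel_left₀ hpos]
  rw [h, map_smul, smul_inv_smul₀ hpos]

theorem norm_grad_distWeight_le_one {X : M → F} (o : M) {p : M}
    (hX : ContDiffAt ℝ 2 (localRep X p) (base n p))
    (hli : LinearIndependent ℝ fun i => pd i (localRep X p) (base n p)) :
    ‖grad n X (distWeight X o) p‖ ≤ 1 := by
  have hpos : 0 < distWeight X o p := zero_lt_one.trans_le (one_le_distWeight X o p)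
  have h : distWeight X o p * ‖grad n X (distWeight X o) p‖ ≤ distWeight X o p * 1 := by
    rw [← Real.norm_of_nonneg hpos.le, ← norm_smul, Real.norm_of_nonneg hpos.le,
      distWeight_smul_grad o hX hli, mul_one]
    exact (Submodule.norm_starProjection_apply_le _ _).trans (extrinsicDist_le_distWeight X o p)
  exact le_of_mul_le_mul_left h hpos

/-- `γ Δγ = n + ⟨H, X - X(o)⟩ - |∇γ|²`, from the Gauss formula. -/
theorem distWeight_mul_laplacian {X : M → F} (o : M) {p : M}
    (hX : ContDiffAt ℝ 2 (localRep X p) (base n p))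
    (hli : LinearIndependent ℝ fun i => pd i (localRep X p) (base n p)) :
    distWeight X o p * laplacian n X (distWeight X o) p =
      n + inner ℝ (meanCurvature n X p) (X p - X o) -
        ∑ i, ∑ j, invMetric n X p i j * (pd i (localRep (distWeight X o) p) (base n p) *
          pd j (localRep (distWeight X o) p) (base n p)) := by
  rw [← sum_invMetric_mul_metric (p := p) hli]
  simp_rw [laplacian, meanCurvature, Finset.mul_sum, sum_inner, ← Finset.sum_add_distrib,
    ← Finset.sum_sub_distrib]
  refine Finset.sum_congr rfl fun i _ => Finset.sum_congr rfl fun j _ => ?_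
  have hΓ : distWeight X o p * ∑ k, christoffel X p k i j *
      pd k (localRep (distWeight X o) p) (base n p) =
      ∑ k, christoffel X p k i j * inner ℝ (pd k (localRep X p) (base n p)) (X p - X o) := by
    rw [Finset.mul_sum]
    refine Finset.sum_congr rfl fun k _ => ?_
    have h := distWeight_mul_pd o hX k
    rw [localRep_base, localRep_base] at h
    rw [← h]
    ring
  rw [real_inner_smul_left, secondFundamentalForm_eq hX hli, inner_sub_left, sum_inner]
  simp_rw [real_inner_smul_left]
  rw [← hΓ]
  linear_combination invMetric n X p i j * distWeight_mul_pd_pd o hX i j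

/-- On a translator, `γ L_II γ = n + ⟨V, X - X(o)⟩ - |∇γ|²`: the normal part of `V` comes from the
mean curvature and the tangential part from the drift. Since `|X - X(o)| ≤ γ` and `1 ≤ γ`, this is
at most `γ (n + 1)`. -/
theorem driftLaplacian_distWeight_le {V : F} {X : M → F} (o : M) {p : M}
    (hX : ContDiffAt ℝ 2 (localRep X p) (base n p))
    (hli : LinearIndependent ℝ fun i => pd i (localRep X p) (base n p)) (hV : ‖V‖ = 1)
    (hH : meanCurvature n X p = normalPart n X p V) :
    driftLaplacian n V X (distWeight X o) p ≤ n + 1 := by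
  have hone := one_le_distWeight X o p
  have hpos : 0 < distWeight X o p := zero_lt_one.trans_le hone
  have hlap := distWeight_mul_laplacian o hX hli
  have hgrad : distWeight X o p * inner ℝ V (grad n X (distWeight X o) p) =
      inner ℝ ((tangentImage n X p).starProjection V) (X p - X o) := by
    rw [← real_inner_smul_right, distWeight_smul_grad o hX hli,
      Submodule.inner_starProjection_left_eq_right]
  have hnonneg : 0 ≤ ∑ i, ∑ j, invMetric n X p i j *
      (pd i (localRep (distWeight X o) p) (base n p) *
        pd j (localRep (distWeight X o) p) (base n p)) := by
    have := (posSemidef_invMetric X p).dotProduct_mulVec_nonneg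
      (fun i => pd i (localRep (distWeight X o) p) (base n p))
    simp only [dotProduct, Matrix.mulVec, Finset.mul_sum, star_trivial] at this
    refine this.trans_eq (Finset.sum_congr rfl fun i _ => Finset.sum_congr rfl fun j _ => ?_)
    ring
  have hin : inner ℝ V (X p - X o) ≤ distWeight X o p := by
    refine (real_inner_le_norm _ _).trans ?_
    rw [hV, one_mul]
    exact extrinsicDist_le_distWeight X o p
  rw [hH, normalPart_eq_sub, inner_sub_left] at hlap
  have hn : (n : ℝ) ≤ distWeight X o p * n := le_mul_of_one_le_left n.cast_nonneg hone
  refine le_of_mul_le_mul_left ?_ hpos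
  rw [driftLaplacian, mul_add]
  linarith

end Weight

/-! ### Maximizing sequences -/

section Sequence

theorem continuous_distWeight {M : Type*} [TopologicalSpace M] {F : Type*}
    [NormedAddCommGroup F] {X : M → F} (hX : Continuous X) (o : M) :
    Continuous (distWeight X o) := by
  unfold distWeight extrinsicDist
  fun_prop

/-- Subtracting any positive multiple of `√(1 + r²)` from a function of sublinear growth makes it
tend to `-∞` at infinity, so the difference attains its maximum. -/
theorem exists_isMax_sub_distWeight {M : Type*} [TopologicalSpace M] {F : Type*}
    [NormedAddCommGroup F] [InnerProductSpace ℝ F] [FiniteDimensional ℝ F] {X : M → F}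
    (hproper : IsProperMap X) (o : M) {f : M → ℝ} (hf : Continuous f)
    (hlim : Tendsto (fun x => f x / extrinsicDist X o x)
      (comap (extrinsicDist X o) atTop) (𝓝 0)) {ε : ℝ} (hε : 0 < ε) :
    ∃ p, ∀ x, f x - ε * distWeight X o x ≤ f p - ε * distWeight X o p := by
  have hr : Tendsto (extrinsicDist X o) (cocompact M) atTop := by
    have h1 : Tendsto (fun y : F => ‖y - X o‖) (cocompact F) atTop :=
      tendsto_norm_cocompact_atTop.comp
        (Homeomorph.subRight (X o)).isClosedEmbedding.tendsto_cocompact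
    exact h1.comp (isProperMap_iff_tendsto_cocompact.mp hproper).2
  have hle := tendsto_iff_comap.mp hr
  refine (hf.sub ((continuous_distWeight hproper.continuous o).const_mul ε)).exists_forall_ge' o ?_
  -- far out `f < (ε / 2) r`, so `f - ε γ < -(ε / 2) r`; the radius is chosen so that the latter is
  -- at most the value of `f - ε γ` at `o`
  have hlarge := hr.eventually_ge_atTop
    (max 1 (-(f o - ε * distWeight X o o) / (ε / 2)))
  filter_upwards [hlarge, (hlim.mono_left hle).eventually_lt_const (half_pos hε)] with x h1 h2
  have hpos : 0 < extrinsicDist X o x := zero_lt_one.trans_le ((le_max_left _ _).trans h1)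
  rw [div_lt_iff₀ hpos] at h2
  have h3 := (div_le_iff₀ (half_pos hε)).mp ((le_max_right _ _).trans h1)
  have h4 := mul_le_mul_of_nonneg_left (extrinsicDist_le_distWeight X o x) hε.le
  simp only [Pi.sub_apply]
  linarith

/-- Maximum points of `f - ε γ` form a maximizing sequence for `f` as `ε → 0`, whether or not `f` is
bounded above: at such a point `f` is at least `f y - ε γ y`, for every `y`. -/
theorem tendsto_iSup_of_isMax {M : Type*} {f γ : M → ℝ} (hγ : ∀ x, 0 ≤ γ x) {ε : ℕ → ℝ}
    (hε : ∀ k, 0 ≤ ε k) (hε0 : Tendsto ε atTop (𝓝 0)) {x : ℕ → M}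
    (hx : ∀ k y, f y - ε k * γ y ≤ f (x k) - ε k * γ (x k)) :
    Tendsto (fun k => (f (x k) : EReal)) atTop (𝓝 (⨆ y, (f y : EReal))) := by
  refine tendsto_order.mpr ⟨fun a ha => ?_, fun a ha => Eventually.of_forall fun k =>
    (le_iSup (fun y => (f y : EReal)) (x k)).trans_lt ha⟩
  obtain ⟨y, hy⟩ := lt_iSup_iff.mp ha
  have h : Tendsto (fun k => f y - ε k * γ y) atTop (𝓝 (f y)) := by
    simpa using (hε0.mul_const (γ y)).const_sub (f y)
  filter_upwards [(continuous_coe_real_ereal.tendsto _).comp h |>.eventually_const_lt hy] with k hk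
  refine hk.trans_le (EReal.coe_le_coe_iff.mpr ?_)
  have := mul_nonneg (hε k) (hγ (x k))
  linarith [hx k y]

end Sequence

end TranslatingSoliton

open TranslatingSoliton in
theorem mainTheorem4 {n m : ℕ} {M : Type*} [TopologicalSpace M] [T2Space M]
    [SecondCountableTopology M] [ChartedSpace (EuclideanSpace ℝ (Fin n)) M]
    [IsManifold (𝓡 n) ∞ M]
    (V : EuclideanSpace ℝ (Fin (m + n))) (X : M → EuclideanSpace ℝ (Fin (m + n)))
    (hX : TranslatingSoliton.IsTranslator n V X) (hproper : IsProperMap X)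
    (o : M) (f : M → ℝ) (hf : ContMDiff (𝓡 n) 𝓘(ℝ, ℝ) 2 f)
    (hlim : Tendsto (fun x => f x / TranslatingSoliton.extrinsicDist X o x)
      (comap (TranslatingSoliton.extrinsicDist X o) atTop) (𝓝 0)) :
    ∃ x : ℕ → M,
      Tendsto (fun k => (f (x k) : EReal)) atTop (𝓝 (⨆ y, (f y : EReal))) ∧
      Tendsto (fun k => ‖TranslatingSoliton.grad n X f (x k)‖) atTop (𝓝 0) ∧
      ∃ ℓ : EReal, ℓ ≤ 0 ∧
        Tendsto (fun k => (TranslatingSoliton.driftLaplacian n V X f (x k) : EReal))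
          atTop (𝓝 ℓ) := by
  have hX2 : ∀ p, ContDiffAt ℝ 2 (localRep X p) (base n p) := fun p =>
    contDiffAt_localRep ((hX.smooth p).of_le (by norm_cast))
  have hli : ∀ p, LinearIndependent ℝ fun i => pd i (localRep X p) (base n p) := fun p =>
    linearIndependent_pd_localRep ((hX.smooth p).mdifferentiableAt (by simp)) (hX.immersion p)
  have hε : ∀ k : ℕ, (0 : ℝ) < 1 / ((k : ℝ) + 1) := fun k => Nat.one_div_pos_of_nat
  have hε0 : Tendsto (fun k : ℕ => 1 / ((k : ℝ) + 1)) atTop (𝓝 0) :=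
    tendsto_one_div_add_atTop_nhds_zero_nat
  choose x hx using fun k =>
    exists_isMax_sub_distWeight hproper o hf.continuous hlim (hε k)
  have hbound : ∀ k : ℕ, ‖grad n X f (x k)‖ ≤ 1 / ((k : ℝ) + 1) ∧
      driftLaplacian n V X f (x k) ≤ 1 / ((k : ℝ) + 1) * (n + 1) := by
    intro k
    have hmax : IsLocalMax (localRep (fun y => f y - 1 / ((k : ℝ) + 1) * distWeight X o y) (x k))
        (base n (x k)) := Eventually.of_forall fun u => by
      rw [localRep_base]
      exact hx k _
    obtain ⟨h1, h2⟩ := grad_eq_and_driftLaplacian_le_of_isLocalMax (V := V) (X := X)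
      (contDiffAt_localRep (hf (x k))) (contDiffAt_localRep_distWeight o (hX2 (x k))) hmax
    constructor
    · rw [h1, norm_smul, Real.norm_of_nonneg (hε k).le]
      exact mul_le_of_le_one_right (hε k).le (norm_grad_distWeight_le_one o (hX2 _) (hli _))
    · exact h2.trans (mul_le_mul_of_nonneg_left (driftLaplacian_distWeight_le o (hX2 _) (hli _)
        hX.norm_eq_one (hX.meanCurvature_eq _)) (hε k).le)
  have hsup := tendsto_iSup_of_isMax (fun y => zero_le_one.trans (one_le_distWeight X o y))
    (fun k => (hε k).le) hε0 hx
  have hgrad : Tendsto (fun k => ‖grad n X f (x k)‖) atTop (𝓝 0) :=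
    squeeze_zero (fun k => norm_nonneg _) (fun k => (hbound k).1) hε0
  -- the drift Laplacians are only bounded above, so their limit may be `-∞`
  obtain ⟨ℓ, φ, hφ, hℓ⟩ := CompactSpace.tendsto_subseq
    fun k => (driftLaplacian n V X f (x k) : EReal)
  refine ⟨x ∘ φ, hsup.comp hφ.tendsto_atTop, hgrad.comp hφ.tendsto_atTop, ℓ, ?_, hℓ⟩
  have hupper : Tendsto (fun k : ℕ => ((1 / ((φ k : ℝ) + 1) * (n + 1) : ℝ) : EReal)) atTop
      (𝓝 0) := by
    have h : Tendsto (fun k : ℕ => 1 / ((k : ℝ) + 1) * ((n : ℝ) + 1)) atTop (𝓝 0) := by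
      simpa using hε0.mul_const ((n : ℝ) + 1)
    exact (continuous_coe_real_ereal.tendsto 0).comp (h.comp hφ.tendsto_atTop)
  exact le_of_tendsto_of_tendsto' hℓ hupper fun k => EReal.coe_le_coe_iff.mpr (hbound (φ k)).2
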